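/- Let $\xi=(\xi_i)_{i\ge 0}$ be a sequence of positive reals and let $\psi:[0,\infty)\to[0,\infty)$ be the continuous function with $\psi(0)=0$ that is affine with slope $\xi_m$ on each $[m,m+1]$; write $\hat k=\psi(k)$. For $k\ge 4$ let $D_I(k)=\{(x,y): x\ge 2,\ y\ge x,\ xy\le k\}$, and for an even number $\alpha\ge 16$ let $D_S(k)=\{(x,y): x\ge 2,\ y\ge x,\ \alpha-k\le xy\le\alpha-4\}$. Let $\hat A_I$ and $\hat A_S$ be the areas of $(\psi\times\psi)(D_I(k))$ and $(\psi\times\psi)(D_S(k))$. For $k_0\ge 4$, on $k\in(k_0,k_0+1)$ the second derivative of $\hat A_I$ with respect to $\psi(k)$ is $\frac{1}{\xi_{k_0}^2}\cdot\frac1k\cdot P_{I,k_0}(\xi)$, with a polynomial $P_{I,k_0}$ that is the same for all $\xi$; put $x_{k_0}=P_{I,k_0}(\xi)$. For $4\le k_0\le\frac\alpha2-1$, on $k\in(k_0,k_0+1)$ the second derivative of $\hat A_S$ with respect to $\psi(\alpha-k)$ is $\frac{1}{\xi_{\alpha-k_0-1}^2}\cdot\frac1{\alpha-k}\cdot P_{S,k_0}(\xi)$,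 with a polynomial $P_{S,k_0}$ that is the same for all $\xi$; put $y_{k_0}=P_{S,k_0}(\xi)$. Let $\alpha\ge 16$ be even, and let $\mathfrak P$ be the set of primes $p$ with $5\le p\le\frac\alpha2-1$. A Goldbach Conjecture function associated to $\alpha$ with coefficients $\xi$ (all $\xi_i>0$) is the function $\mathfrak G$ on $[\psi(4),\psi(\alpha/2)]$ with $$\mathfrak G(\psi(k))=\frac{x_{k_0}}{\xi_{k_0}^2}\cdot\frac1k+\frac{y_{k_0}}{\xi_{\alpha-k_0-1}^2}\cdot\frac1{\alpha-k}\qquad\Bigl(k\in[k_0,k_0+1],\ k_0=4,\dots,\tfrac\alpha2-1\Bigr),$$ where $\xi_0<\xi_1<\dots<\xi_5$; $\xi_p>\xi_{p-1}$ for $p\in\mathfrak P$; for every non-prime $k$ with $5\le k\le\frac\alpha2-1$, $\xi_k^2=\frac{x_k}{x_{k-1}}\xi_{k-1}^2$ and $\xi_{\alpha-k}^2=|y_{k-1}|\,|y_k|^{-1}\,\xi_{\alpha-k-1}^2$; and for every $p\in\mathfrak P$, $$\xi_{\alpha-p}^2=|y_{p-1}|\left(\frac{|y_p|}{\xi_{\alpha-p-1}^2}+\frac{\alpha-p}{p}\,x_{p-1}\left(\frac1{\xi_{p-1}^2}-\frac1{\xi_p^2}\right)\right)^{-1}.$$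 Such a function is called scalar with parameter $u>1$, and written $\mathfrak G(\xi_2^2,\xi_{\alpha/2}^2,u)$, if $\xi_i^2=u^2\xi_{i-1}^2$ for all $i\in\{3,4\}\cup\mathfrak P$. Proposition. Let $\alpha\ge16$ be even, and for each $u>1$ let $\mathfrak G=\mathfrak G(\xi_2^2,\xi_{\alpha/2}^2,u)$ be a scalar Goldbach Conjecture function associated to $\alpha$, with $\xi_2^2$ and $\xi_{\alpha/2}^2$ independent of $u$. Then $$\lim_{u\to1^+}x_{k_0}=\tfrac12\xi_2^2\quad\text{for every integer } 4\le k_0\le\alpha-5,$$ $$\lim_{u\to1^+}|y_{k_0}|=\tfrac12\xi_2^2\quad\text{for every integer } 4\le k_0\le\tfrac\alpha2-1.$$ -/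

import Mathlib

open Filter Topology MeasureTheory Set

noncomputable section

namespace Goldbach

/-- The piecewise affine coding function `ψ` with coefficients `ξ`: on `[m, m + 1]`,
`ψ x = ξ m * (x - m) + ∑ j < m, ξ j`.  It is used on `[0, ∞)` only. -/
def coding (ξ : ℕ → ℝ) (x : ℝ) : ℝ :=
  ξ ⌊x⌋₊ * (x - (⌊x⌋₊ : ℝ)) + ∑ j ∈ Finset.range ⌊x⌋₊, ξ j

/-- The inverse `ψ⁻¹ : ψ([0, ∞)) → [0, ∞)` of the coding function. -/
def decoding (ξ : ℕ → ℝ) : ℝ → ℝ :=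
  Function.invFunOn (coding ξ) (Ici 0)

/-- `D_I(k) = {x ≥ 2, y ≥ x, x y ≤ k}`. -/
def lowerRegion (k : ℝ) : Set (ℝ × ℝ) :=
  {p | 2 ≤ p.1 ∧ p.1 ≤ p.2 ∧ p.1 * p.2 ≤ k}

/-- `D_S(k) = {x ≥ 2, y ≥ x, α - k ≤ x y ≤ α - 4}`. -/
def upperRegion (α : ℕ) (k : ℝ) : Set (ℝ × ℝ) :=
  {p | 2 ≤ p.1 ∧ p.1 ≤ p.2 ∧ (α : ℝ) - k ≤ p.1 * p.2 ∧ p.1 * p.2 ≤ (α : ℝ) - 4}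

/-- The area, for the usual measure of the plane, of the image of a region under `ψ × ψ`. -/
def codedArea (ξ : ℕ → ℝ) (D : Set (ℝ × ℝ)) : ℝ :=
  (volume : Measure (ℝ × ℝ)).real (Prod.map (coding ξ) (coding ξ) '' D)

/-- The lower area as a function of the coded variable `s = ψ k`. -/
def lowerArea (ξ : ℕ → ℝ) (s : ℝ) : ℝ :=
  codedArea ξ (lowerRegion (decoding ξ s))

/-- The upper area as a function of the coded variable `s = ψ (α - k)`. -/
def upperArea (α : ℕ) (ξ : ℕ → ℝ) (s : ℝ) : ℝ :=
  codedArea ξ (upperRegion α ((α : ℝ) - decoding ξ s))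

/-- On the open set `U`, the function `A` is twice differentiable with second derivative `A₂`. -/
def HasSecondDerivOn (A A₂ : ℝ → ℝ) (U : Set ℝ) : Prop :=
  ∃ A₁ : ℝ → ℝ, ∀ s ∈ U, HasDerivAt A (A₁ s) s ∧ HasDerivAt A₁ (A₂ s) s

/-- `P` is the polynomial left in the second derivative of the lower area, on the coded interval
`(ψ k₀, ψ (k₀ + 1))`, after removing the factor `1 / ξ_{k₀}² * 1 / k`, where `k = ψ⁻¹ s`;
this is required for every coding, so it determines `P`. -/
def IsLowerEssentialPolynomial (k₀ : ℕ) (P : MvPolynomial ℕ ℝ) : Prop :=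
  ∀ ξ : ℕ → ℝ, (∀ i, 0 < ξ i) →
    HasSecondDerivOn (lowerArea ξ)
      (fun s => 1 / ξ k₀ ^ 2 * (1 / decoding ξ s) * MvPolynomial.eval ξ P)
      (Ioo (coding ξ k₀) (coding ξ (k₀ + 1)))

/-- `P` is the polynomial left in the second derivative of the upper area, for
`k ∈ (k₀, k₀ + 1)`, after removing the factor `1 / ξ_{α - k₀ - 1}² * 1 / (α - k)`.
Here `α - k = ψ⁻¹ s` lies in `(α - k₀ - 1, α - k₀)`. -/
def IsUpperEssentialPolynomial (α k₀ : ℕ) (P : MvPolynomial ℕ ℝ) : Prop :=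
  ∀ ξ : ℕ → ℝ, (∀ i, 0 < ξ i) →
    HasSecondDerivOn (upperArea α ξ)
      (fun s => 1 / ξ (α - k₀ - 1) ^ 2 * (1 / decoding ξ s) * MvPolynomial.eval ξ P)
      (Ioo (coding ξ ((α : ℝ) - k₀ - 1)) (coding ξ ((α : ℝ) - k₀)))

/-- The lower essential polynomial `P_{I, k₀}` (for `k₀ ≥ 4`). -/
def lowerEssentialPolynomial (k₀ : ℕ) : MvPolynomial ℕ ℝ :=
  Classical.epsilon (IsLowerEssentialPolynomial k₀)

/-- The upper essential polynomial `P_{S, k₀}` (for `4 ≤ k₀ ≤ α / 2 - 1`). -/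
def upperEssentialPolynomial (α k₀ : ℕ) : MvPolynomial ℕ ℝ :=
  Classical.epsilon (IsUpperEssentialPolynomial α k₀)

/-- The abscissa `x_{k₀}` of the essential point: the value of `P_{I, k₀}` at the coefficients. -/
def essentialX (ξ : ℕ → ℝ) (k₀ : ℕ) : ℝ :=
  MvPolynomial.eval ξ (lowerEssentialPolynomial k₀)

/-- The ordinate `y_{k₀}` of the essential point: the value of `P_{S, k₀}` at the coefficients. -/
def essentialY (α : ℕ) (ξ : ℕ → ℝ) (k₀ : ℕ) : ℝ :=
  MvPolynomial.eval ξ (upperEssentialPolynomial α k₀)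

/-- The coefficients `ξ` are chosen as in the construction of a Goldbach Conjecture function
associated to `α`: free increasing choices up to index `5` and at the primes below `α / 2`, a free
positive choice at `α / 2`, and forced choices at the other indices up to `α - 5`. -/
structure IsGoldbachCoefficients (α : ℕ) (ξ : ℕ → ℝ) : Prop where
  pos : ∀ i, 0 < ξ i
  initial : ∀ i, 1 ≤ i → i ≤ 5 → ξ (i - 1) < ξ i
  lower_prime : ∀ p : ℕ, p.Prime → 5 ≤ p → p ≤ α / 2 - 1 → ξ (p - 1) < ξ p
  lower_not_prime : ∀ k : ℕ, ¬ k.Prime → 5 ≤ k → k ≤ α / 2 - 1 →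
    ξ k ^ 2 = essentialX ξ k / essentialX ξ (k - 1) * ξ (k - 1) ^ 2
  upper_not_prime : ∀ k : ℕ, ¬ k.Prime → 5 ≤ k → k ≤ α / 2 - 1 →
    ξ (α - k) ^ 2 = |essentialY α ξ (k - 1)| * |essentialY α ξ k|⁻¹ * ξ (α - k - 1) ^ 2
  upper_prime : ∀ p : ℕ, p.Prime → 5 ≤ p → p ≤ α / 2 - 1 →
    ξ (α - p) ^ 2 = |essentialY α ξ (p - 1)| *
      (|essentialY α ξ p| / ξ (α - p - 1) ^ 2 +
        ((α : ℝ) - p) / p * essentialX ξ (p - 1) * (1 / ξ (p - 1) ^ 2 - 1 / ξ p ^ 2))⁻¹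

/-- `G` is the Goldbach Conjecture function associated to `α` with coefficients `ξ`.  Its domain is
`[ψ 4, ψ (α / 2)]`; only its values there are prescribed. -/
structure IsGoldbachFunction (α : ℕ) (ξ : ℕ → ℝ) (G : ℝ → ℝ) : Prop where
  coefficients : IsGoldbachCoefficients α ξ
  value : ∀ k₀ : ℕ, 4 ≤ k₀ → k₀ ≤ α / 2 - 1 → ∀ k ∈ Icc (k₀ : ℝ) (k₀ + 1),
    G (coding ξ k) = essentialX ξ k₀ / ξ k₀ ^ 2 * (1 / k) +
      essentialY α ξ k₀ / ξ (α - k₀ - 1) ^ 2 * (1 / ((α : ℝ) - k))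

/-- `G = 𝔊(a, b, lam)`, where `a = ξ₂²`, `b = ξ_{α/2}²`, and `ξ_i² = lam_i² ξ_{i-1}²` with
`lam_i > 1` for `i = 3`, `i = 4` and the primes `i` with `5 ≤ i ≤ α / 2 - 1`. -/
structure IsGoldbachFunctionWith (α : ℕ) (a b : ℝ) (lam : ℕ → ℝ) (ξ : ℕ → ℝ) (G : ℝ → ℝ) :
    Prop where
  isGoldbach : IsGoldbachFunction α ξ G
  sq_two : ξ 2 ^ 2 = a
  sq_half : ξ (α / 2) ^ 2 = b
  ratio : ∀ i : ℕ, i = 3 ∨ i = 4 ∨ (i.Prime ∧ 5 ≤ i ∧ i ≤ α / 2 - 1) →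
    1 < lam i ∧ ξ i ^ 2 = lam i ^ 2 * ξ (i - 1) ^ 2

/-- `G = 𝔊(a, b, u)` is scalar: all `lam_i` are equal to `u`. -/
def IsScalarGoldbachFunction (α : ℕ) (a b u : ℝ) (ξ : ℕ → ℝ) (G : ℝ → ℝ) : Prop :=
  IsGoldbachFunctionWith α a b (fun _ => u) ξ G

end Goldbach

end

noncomputable section

namespace Goldbach

/-! The essential values have a closed form. By change of variables, the area of a coded region is
the integral of `ξ ⌊x⌋₊ * ξ ⌊y⌋₊` over the region. On `x ≥ 2` the slope `ξ ⌊x⌋₊` is the sum of the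
jumps `slopeJump ξ i` over `2 ≤ i ≤ x`, so the lower area is a double sum of products of two jumps
times the area of `lowerRegion k` cut by a quadrant with integer corner. Each such area combines
functions `k * log (k / (i * j)) - k + i * j`, which vanish for `k < i * j` and have second
derivative `1 / k` beyond. Hence `x_{k₀}` is the quadratic form `lowerValue ξ k₀` in the jumps of
index at most `k₀ / 2` (`essentialX_eq`). The upper region is the complement of a lower one in a
fixed region, so `y_{k₀} = -lowerValue ξ (α - k₀ - 1)` (`essentialY_eq`).

If the coefficients of index `2, ..., k₀ / 2` all tend to `√a`, every jump but the one at `2` tends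
to `0`, and the form tends to `a / 2` (`tendsto_lowerValue`). That they do so is a strong induction
(`tendsto_coefficient`): `ξ_i² / ξ_{i-1}²` is either `u²` or `x_i / x_{i-1}`, and the latter
involves only indices up to `i / 2`, so it tends to `1` by induction. -/

/-! ### The coding function and its inverse -/

lemma coding_eq_of_mem_Ico (ξ : ℕ → ℝ) (n : ℕ) {x : ℝ} (hx : x ∈ Ico (n : ℝ) (n + 1)) :
    coding ξ x = ξ n * (x - n) + ∑ j ∈ Finset.range n, ξ j := by
  have h : ⌊x⌋₊ = n := (Nat.floor_eq_iff ((Nat.cast_nonneg n).trans hx.1)).2 hx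
  rw [coding, h]

lemma coding_natCast (ξ : ℕ → ℝ) (n : ℕ) : coding ξ n = ∑ j ∈ Finset.range n, ξ j := by
  simp [coding]

lemma coding_natCast_add_one (ξ : ℕ → ℝ) (n : ℕ) :
    coding ξ ((n : ℝ) + 1) = coding ξ n + ξ n := by
  have := coding_natCast ξ (n + 1)
  push_cast at this
  rw [this, coding_natCast, Finset.sum_range_succ]

lemma strictMonoOn_coding {ξ : ℕ → ℝ} (hξ : ∀ i, 0 < ξ i) :
    StrictMonoOn (coding ξ) (Ici 0) := by
  intro x hx y hy hxy
  have hx1 := Nat.floor_le (mem_Ici.1 hx)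
  have hx2 := Nat.lt_floor_add_one x
  have hy1 := Nat.floor_le (mem_Ici.1 hy)
  rcases (Nat.floor_mono hxy.le).eq_or_lt with h | h
  · unfold coding
    rw [h]
    have := mul_lt_mul_of_pos_left (sub_lt_sub_right hxy (⌊y⌋₊ : ℝ)) (hξ ⌊y⌋₊)
    linarith
  · have h1 : ξ ⌊x⌋₊ * (x - ⌊x⌋₊) < ξ ⌊x⌋₊ :=
      mul_lt_of_lt_one_right (hξ _) (by linarith)
    have h2 : ∑ j ∈ Finset.range (⌊x⌋₊ + 1), ξ j ≤ ∑ j ∈ Finset.range ⌊y⌋₊, ξ j :=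
      Finset.sum_le_sum_of_subset_of_nonneg (Finset.range_subset_range.2 h)
        fun i _ _ => (hξ i).le
    have h3 : 0 ≤ ξ ⌊y⌋₊ * (y - ⌊y⌋₊) := mul_nonneg (hξ _).le (by linarith)
    rw [Finset.sum_range_succ] at h2
    unfold coding
    linarith

lemma decoding_coding {ξ : ℕ → ℝ} (hξ : ∀ i, 0 < ξ i) {x : ℝ} (hx : 0 ≤ x) :
    decoding ξ (coding ξ x) = x :=
  (strictMonoOn_coding hξ).injOn.leftInvOn_invFunOn (mem_Ici.2 hx)

/-- On a coded unit interval, decoding is affine. -/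
lemma decoding_eq {ξ : ℕ → ℝ} (hξ : ∀ i, 0 < ξ i) (n : ℕ) {s : ℝ}
    (hs : s ∈ Ioo (coding ξ n) (coding ξ ((n : ℝ) + 1))) :
    decoding ξ s = n + (s - coding ξ n) / ξ n ∧
      decoding ξ s ∈ Ioo (n : ℝ) (n + 1) := by
  rw [coding_natCast_add_one] at hs
  have h0 : 0 < (s - coding ξ n) / ξ n := div_pos (by linarith [hs.1]) (hξ n)
  have h1 : (s - coding ξ n) / ξ n < 1 := by
    rw [div_lt_one (hξ n)]
    linarith [hs.2]
  have hc : coding ξ (n + (s - coding ξ n) / ξ n) = s := by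
    rw [coding_eq_of_mem_Ico ξ n ⟨by linarith, by linarith⟩, ← coding_natCast]
    have := (hξ n).ne'
    field_simp
    ring
  have hn : (0 : ℝ) ≤ n := Nat.cast_nonneg n
  have := decoding_coding hξ (x := n + (s - coding ξ n) / ξ n) (by linarith)
  rw [hc] at this
  rw [this]
  exact ⟨rfl, by linarith, by linarith⟩

lemma hasDerivAt_coding (ξ : ℕ → ℝ) {x : ℝ} (hx : 0 ≤ x) (hxn : ∀ n : ℕ, x ≠ n) :
    HasDerivAt (coding ξ) (ξ ⌊x⌋₊) x := by
  have h1 : (⌊x⌋₊ : ℝ) < x := lt_of_le_of_ne (Nat.floor_le hx) (hxn _).symm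
  have h : coding ξ =ᶠ[𝓝 x]
      fun y => ξ ⌊x⌋₊ * (y - ⌊x⌋₊) + ∑ j ∈ Finset.range ⌊x⌋₊, ξ j := by
    filter_upwards [Ioo_mem_nhds h1 (Nat.lt_floor_add_one x)] with y hy
    exact coding_eq_of_mem_Ico ξ _ ⟨hy.1.le, hy.2⟩
  refine HasDerivAt.congr_of_eventuallyEq ?_ h
  simpa using (((hasDerivAt_id x).sub_const (⌊x⌋₊ : ℝ)).const_mul (ξ ⌊x⌋₊)).add_const
    (∑ j ∈ Finset.range ⌊x⌋₊, ξ j)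

/-! ### Coded areas as integrals -/

/-- The area of a coded region, by change of variables. -/
lemma codedArea_eq_integral {ξ : ℕ → ℝ} (hξ : ∀ i, 0 < ξ i) {D : Set (ℝ × ℝ)}
    (hD : MeasurableSet D) (hD0 : ∀ p ∈ D, 0 ≤ p.1 ∧ 0 ≤ p.2) :
    codedArea ξ D = ∫ p in D, ξ ⌊p.1⌋₊ * ξ ⌊p.2⌋₊ := by
  set f : ℝ × ℝ → ℝ × ℝ := Prod.map (coding ξ) (coding ξ) with hf
  -- Needed for two families of lines: `v n = n`, where `ψ × ψ` may fail to be differentiable, and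
  -- `v n = ψ n`, which contains the images of those lines.
  have hnull : ∀ v : ℕ → ℝ, volume (⋃ n : ℕ, ({v n} ×ˢ univ ∪ univ ×ˢ {v n} : Set (ℝ × ℝ))) = 0 := by
    intro v
    refine measure_iUnion_null fun n => measure_union_null ?_ ?_ <;>
      simp [Measure.volume_eq_prod]
  set g : Set (ℝ × ℝ) := ⋃ n : ℕ, ({(n : ℝ)} ×ˢ univ ∪ univ ×ˢ {(n : ℝ)} : Set (ℝ × ℝ)) with hg
  have hgm : MeasurableSet g := MeasurableSet.iUnion fun n =>
    ((measurableSet_singleton _).prod MeasurableSet.univ).union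
      (MeasurableSet.univ.prod (measurableSet_singleton _))
  have hmem : ∀ p, p ∉ g → (∀ n : ℕ, p.1 ≠ n) ∧ ∀ n : ℕ, p.2 ≠ n := by
    intro p hp
    simp only [hg, mem_iUnion, mem_union, mem_prod, mem_singleton_iff, mem_univ, and_true,
      true_and, not_exists, not_or] at hp
    exact ⟨fun n => (hp n).1, fun n => (hp n).2⟩
  have h1 : f '' D =ᵐ[volume] f '' (D \ g) := by
    have hsub : f '' D \ f '' (D \ g) ⊆
        ⋃ n : ℕ, ({coding ξ n} ×ˢ univ ∪ univ ×ˢ {coding ξ n} : Set (ℝ × ℝ)) := by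
      rintro _ ⟨⟨p, hp, rfl⟩, hq⟩
      have hpg : p ∈ g := by
        by_contra hpg
        exact hq ⟨p, ⟨hp, hpg⟩, rfl⟩
      simp only [hg, mem_iUnion, mem_union, mem_prod, mem_singleton_iff, mem_univ, and_true,
        true_and] at hpg
      obtain ⟨n, hn | hn⟩ := hpg
      · exact mem_iUnion.2 ⟨n, Or.inl (by simp [hf, hn])⟩
      · exact mem_iUnion.2 ⟨n, Or.inr (by simp [hf, hn])⟩
    exact (ae_le_set.2 (measure_mono_null hsub (hnull _))).antisymm
      (LE.le.eventuallyLE (image_mono sdiff_subset))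
  have h2 : D =ᵐ[volume] (D \ g : Set (ℝ × ℝ)) :=
    (sdiff_null_ae_eq_self (hnull fun n => (n : ℝ))).symm
  have hder : ∀ p ∈ D \ g, HasFDerivWithinAt f
      (((ContinuousLinearMap.toSpanSingleton ℝ (ξ ⌊p.1⌋₊))).prodMap
        (ContinuousLinearMap.toSpanSingleton ℝ (ξ ⌊p.2⌋₊))) (D \ g) p := by
    intro p hp
    obtain ⟨ha, hb⟩ := hmem p hp.2
    exact (HasFDerivAt.prodMap p (hasDerivAt_coding ξ (hD0 p hp.1).1 ha).hasFDerivAt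
      (hasDerivAt_coding ξ (hD0 p hp.1).2 hb).hasFDerivAt).hasFDerivWithinAt
  have hinj : InjOn f (D \ g) := by
    intro p hp q hq hpq
    have h := (strictMonoOn_coding hξ).injOn
    simp only [hf, Prod.map, Prod.mk.injEq] at hpq
    exact Prod.ext (h (hD0 p hp.1).1 (hD0 q hq.1).1 hpq.1) (h (hD0 p hp.1).2 (hD0 q hq.1).2 hpq.2)
  -- With the constant integrand `1`, the left side is the area of the image and the right side the
  -- integral of the Jacobian.
  have key := integral_image_eq_integral_abs_det_fderiv_smul volume (hD.diff hgm) hder hinj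
    (fun _ => (1 : ℝ))
  rw [codedArea, measureReal_congr h1, setIntegral_congr_set h2]
  simp only [integral_const, smul_eq_mul, mul_one, measureReal_restrict_apply_univ] at key
  rw [key]
  refine integral_congr_ae (ae_of_all _ fun p => ?_)
  have : (((ContinuousLinearMap.toSpanSingleton ℝ (ξ ⌊p.1⌋₊))).prodMap
        (ContinuousLinearMap.toSpanSingleton ℝ (ξ ⌊p.2⌋₊))).det = ξ ⌊p.1⌋₊ * ξ ⌊p.2⌋₊ := by
    rw [ContinuousLinearMap.det, ContinuousLinearMap.coe_prodMap, LinearMap.det_prodMap]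
    simp [LinearMap.det_ring]
  simp only [this]
  exact abs_of_pos (mul_pos (hξ _) (hξ _))

/-! ### Areas under a hyperbola -/

/-- The part of the quadrant with corner `(i, j)` that lies below the hyperbola `x y = k`. -/
def hyperbolicQuadrant (i j k : ℝ) : Set (ℝ × ℝ) :=
  {p | i ≤ p.1 ∧ j ≤ p.2 ∧ p.1 * p.2 ≤ k}

/-- The part of `hyperbolicQuadrant i i k` on or above the diagonal. -/
def hyperbolicSector (i k : ℝ) : Set (ℝ × ℝ) :=
  {p | i ≤ p.1 ∧ p.1 ≤ p.2 ∧ p.1 * p.2 ≤ k}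

/-- The area of `hyperbolicQuadrant i j k`. -/
def hyperbolicArea (i j k : ℝ) : ℝ :=
  if i * j ≤ k then k * Real.log (k / (i * j)) - k + i * j else 0

lemma measurableSet_hyperbolicQuadrant (i j k : ℝ) :
    MeasurableSet (hyperbolicQuadrant i j k) :=
  (measurableSet_le measurable_const measurable_fst).inter
    ((measurableSet_le measurable_const measurable_snd).inter
      (measurableSet_le (measurable_fst.mul measurable_snd) measurable_const))

lemma measurableSet_hyperbolicSector (i k : ℝ) : MeasurableSet (hyperbolicSector i k) :=
  (measurableSet_le measurable_const measurable_fst).inter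
    ((measurableSet_le measurable_fst measurable_snd).inter
      (measurableSet_le (measurable_fst.mul measurable_snd) measurable_const))

lemma integral_div_sub {i j k : ℝ} (hi : 0 < i) (hj : 0 < j) (hk : i * j ≤ k) :
    ∫ x in i..(k / j), (k / x - j) = k * Real.log (k / (i * j)) - k + i * j := by
  have hk0 : 0 < k := (mul_pos hi hj).trans_le hk
  have hkj : i ≤ k / j := (le_div_iff₀ hj).2 hk
  have hpos : ∀ x ∈ uIcc i (k / j), 0 < x := by
    intro x hx
    rw [uIcc_of_le hkj] at hx
    exact hi.trans_le hx.1
  have hd : ∀ x ∈ uIcc i (k / j),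
      HasDerivAt (fun x => k * Real.log x - j * x) (k / x - j) x := by
    intro x hx
    have h := ((Real.hasDerivAt_log (hpos x hx).ne').const_mul k).fun_sub
      ((hasDerivAt_id x).const_mul j)
    simpa [div_eq_mul_inv] using h
  have hc : ContinuousOn (fun x => k / x - j) (uIcc i (k / j)) :=
    (continuousOn_const.div continuousOn_id fun x hx => (hpos x hx).ne').sub continuousOn_const
  rw [intervalIntegral.integral_eq_sub_of_hasDerivAt hd hc.intervalIntegrable,
    Real.log_div hk0.ne' hj.ne', Real.log_div hk0.ne' (mul_pos hi hj).ne',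
    Real.log_mul hi.ne' hj.ne']
  field_simp
  ring

lemma volume_hyperbolicQuadrant {i j : ℝ} (hi : 0 < i) (hj : 0 < j) (k : ℝ) :
    volume (hyperbolicQuadrant i j k) = ENNReal.ofReal (hyperbolicArea i j k) := by
  unfold hyperbolicArea
  split_ifs with hk
  · have hkj : i ≤ k / j := (le_div_iff₀ hj).2 hk
    have hslice : (fun x => volume (Prod.mk x ⁻¹' hyperbolicQuadrant i j k)) =
        (Icc i (k / j)).indicator fun x => ENNReal.ofReal (k / x - j) := by
      funext x
      by_cases hx : x ∈ Icc i (k / j)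
      · have hx0 : 0 < x := hi.trans_le hx.1
        have : Prod.mk x ⁻¹' hyperbolicQuadrant i j k = Icc j (k / x) := by
          ext y
          simp only [hyperbolicQuadrant, mem_preimage, mem_ofPred_eq, mem_Icc, le_div_iff₀ hx0,
            mul_comm y x]
          exact ⟨fun h => h.2, fun h => ⟨hx.1, h⟩⟩
        rw [indicator_of_mem hx, this, Real.volume_Icc]
      · have : Prod.mk x ⁻¹' hyperbolicQuadrant i j k = ∅ := by
          refine eq_empty_of_forall_notMem fun y hy => hx ⟨hy.1, (le_div_iff₀ hj).2 ?_⟩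
          exact (mul_le_mul_of_nonneg_left hy.2.1 (hi.le.trans hy.1)).trans hy.2.2
        rw [indicator_of_notMem hx, this, measure_empty]
    have hc : ContinuousOn (fun x => k / x - j) (Icc i (k / j)) :=
      (continuousOn_const.div continuousOn_id fun x hx => (hi.trans_le hx.1).ne').sub
        continuousOn_const
    rw [Measure.volume_eq_prod, Measure.prod_apply (measurableSet_hyperbolicQuadrant i j k),
      hslice, lintegral_indicator measurableSet_Icc,
      ← ofReal_integral_eq_lintegral_ofReal hc.integrableOn_Icc, integral_Icc_eq_integral_Ioc,
      ← intervalIntegral.integral_of_le hkj, integral_div_sub hi hj hk]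
    refine (ae_restrict_iff' measurableSet_Icc).2 (ae_of_all _ fun x hx => ?_)
    have hx0 : 0 < x := hi.trans_le hx.1
    have := (le_div_iff₀ hj).1 hx.2
    simp only [Pi.zero_apply, sub_nonneg]
    rwa [le_div_iff₀ hx0, mul_comm]
  · have : hyperbolicQuadrant i j k = ∅ := by
      refine eq_empty_of_forall_notMem fun p hp => hk ?_
      exact (mul_le_mul hp.1 hp.2.1 hj.le (hi.le.trans hp.1)).trans hp.2.2
    simp [this]

lemma hyperbolicArea_nonneg {i j : ℝ} (hi : 0 < i) (hj : 0 < j) (k : ℝ) :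
    0 ≤ hyperbolicArea i j k := by
  unfold hyperbolicArea
  split_ifs with hk
  · have hij := mul_pos hi hj
    have hk0 := hij.trans_le hk
    -- The bound `1 - 1 / t ≤ log t` at `t = k / (i * j)`, multiplied by `k`, is exactly the claim.
    have := Real.one_sub_inv_le_log_of_pos (div_pos hk0 hij)
    have h2 := mul_le_mul_of_nonneg_left this hk0.le
    have h3 : k * (1 - (k / (i * j))⁻¹) = k - i * j := by field_simp
    linarith
  · exact le_rfl

lemma volumeReal_hyperbolicQuadrant {i j : ℝ} (hi : 0 < i) (hj : 0 < j) (k : ℝ) :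
    volume.real (hyperbolicQuadrant i j k) = hyperbolicArea i j k := by
  rw [Measure.real, volume_hyperbolicQuadrant hi hj,
    ENNReal.toReal_ofReal (hyperbolicArea_nonneg hi hj k)]

lemma volume_hyperbolicQuadrant_ne_top {i j : ℝ} (hi : 0 < i) (hj : 0 < j) (k : ℝ) :
    volume (hyperbolicQuadrant i j k) ≠ ⊤ := by
  rw [volume_hyperbolicQuadrant hi hj]
  exact ENNReal.ofReal_ne_top

lemma hyperbolicSector_subset (i k : ℝ) :
    hyperbolicSector i k ⊆ hyperbolicQuadrant i i k :=
  fun _ hp => ⟨hp.1, hp.1.trans hp.2.1, hp.2.2⟩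

lemma volume_diagonal : volume {p : ℝ × ℝ | p.2 = p.1} = 0 := by
  have hm : MeasurableSet {p : ℝ × ℝ | p.2 = p.1} := measurableSet_graph measurable_id
  rw [Measure.volume_eq_prod, Measure.measure_prod_null hm]
  refine ae_of_all _ fun x => ?_
  have : Prod.mk x ⁻¹' {p : ℝ × ℝ | p.2 = p.1} = {x} := by
    ext y
    simp
  simp [this]

lemma volumeReal_swap_preimage {S : Set (ℝ × ℝ)} (hS : MeasurableSet S) :
    volume.real (Prod.swap ⁻¹' S) = volume.real S :=
  (Measure.measurePreserving_swap (μ := (volume : Measure ℝ))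
    (ν := (volume : Measure ℝ))).measureReal_preimage hS.nullMeasurableSet

/-- A quadrant with corner on or above the diagonal is cut by the diagonal into a part above and
the mirror image of a sector. -/
lemma volumeReal_inter_le_add {i j : ℝ} (hi : 0 < i) (hij : i ≤ j) (k : ℝ) :
    volume.real (hyperbolicQuadrant i j k ∩ {p | p.1 ≤ p.2}) +
      volume.real (hyperbolicSector j k) = hyperbolicArea i j k := by
  have hj := hi.trans_le hij
  have hS := (measurable_swap (measurableSet_hyperbolicSector j k))
  have hunion : hyperbolicQuadrant i j k =
      hyperbolicQuadrant i j k ∩ {p | p.1 ≤ p.2} ∪ Prod.swap ⁻¹' hyperbolicSector j k := by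
    ext ⟨x, y⟩
    simp only [hyperbolicQuadrant, hyperbolicSector, mem_union, mem_inter_iff, mem_ofPred_eq,
      mem_preimage, Prod.swap_prod_mk]
    constructor
    · intro h
      rcases le_total x y with hxy | hxy
      · exact Or.inl ⟨h, hxy⟩
      · exact Or.inr ⟨h.2.1, hxy, mul_comm x y ▸ h.2.2⟩
    · rintro (h | h)
      · exact h.1
      · exact ⟨hij.trans (h.1.trans h.2.1), h.1, mul_comm x y ▸ h.2.2⟩
  have htop := volume_hyperbolicQuadrant_ne_top hi hj k
  have hdisj : AEDisjoint volume (hyperbolicQuadrant i j k ∩ {p | p.1 ≤ p.2})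
      (Prod.swap ⁻¹' hyperbolicSector j k) :=
    measure_mono_null (fun p hp => le_antisymm hp.2.2.1 hp.1.2) volume_diagonal
  rw [← volumeReal_hyperbolicQuadrant hi hj k, ← volumeReal_swap_preimage
    (measurableSet_hyperbolicSector j k)]
  conv_rhs => rw [hunion]
  refine (measureReal_union₀ hS.nullMeasurableSet hdisj
    (measure_ne_top_of_subset inter_subset_left htop) (measure_ne_top_of_subset ?_ htop)).symm
  exact fun p hp => hunion ▸ Or.inr hp

lemma volumeReal_hyperbolicSector {i : ℝ} (hi : 0 < i) (k : ℝ) :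
    volume.real (hyperbolicSector i k) = hyperbolicArea i i k / 2 := by
  have h : hyperbolicQuadrant i i k ∩ {p | p.1 ≤ p.2} = hyperbolicSector i k := by
    ext p
    exact ⟨fun hp => ⟨hp.1.1, hp.2, hp.1.2.2⟩,
      fun hp => ⟨hyperbolicSector_subset i k hp, hp.2.1⟩⟩
  have := volumeReal_inter_le_add hi le_rfl k
  rw [h] at this
  linarith

/-- The area of the part of `lowerRegion k` in the quadrant with corner `(i, j)`. -/
lemma volumeReal_lowerRegion_inter {i j : ℝ} (hi : 2 ≤ i) (k : ℝ) :
    volume.real (lowerRegion k ∩ {p | i ≤ p.1 ∧ j ≤ p.2}) =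
      if j ≤ i then hyperbolicArea i i k / 2
      else hyperbolicArea i j k - hyperbolicArea j j k / 2 := by
  have hi0 : 0 < i := by linarith
  -- If `j ≤ i`, the condition `j ≤ y` follows from `i ≤ x ≤ y` and a sector remains; otherwise the
  -- region is the quadrant minus its part below the diagonal.
  split_ifs with h
  · rw [← volumeReal_hyperbolicSector hi0]
    congr 1
    ext p
    exact ⟨fun hp => ⟨hp.2.1, hp.1.2⟩,
      fun hp => ⟨⟨hi.trans hp.1, hp.2⟩, hp.1, h.trans (hp.1.trans hp.2.1)⟩⟩
  · push Not at h
    rw [← volumeReal_inter_le_add hi0 h.le, ← volumeReal_hyperbolicSector (hi0.trans h),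
      add_sub_cancel_right]
    congr 1
    ext p
    exact ⟨fun hp => ⟨⟨hp.2.1, hp.2.2, hp.1.2.2⟩, hp.1.2.1⟩,
      fun hp => ⟨⟨hi.trans hp.1.1, hp.2, hp.1.2.2⟩, hp.1.1, hp.1.2.1⟩⟩

/-! ### Expansion of the area in slope jumps -/

/-- The jumps of the slope of a coding, counted from the slope on `[2, 3]`. -/
def slopeJump (ξ : ℕ → ℝ) (i : ℕ) : ℝ :=
  if i = 2 then ξ 2 else ξ i - ξ (i - 1)

lemma sum_slopeJump (ξ : ℕ → ℝ) {n : ℕ} (hn : 2 ≤ n) :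
    ∑ i ∈ Finset.Icc 2 n, slopeJump ξ i = ξ n := by
  induction n, hn using Nat.le_induction with
  | base => simp [slopeJump]
  | succ n hn ih =>
    rw [Finset.sum_Icc_succ_top (by omega), ih, slopeJump, if_neg (by omega)]
    simp

lemma slope_eq_sum (ξ : ℕ → ℝ) {N : ℕ} {x : ℝ} (h2 : 2 ≤ x) (hN : x < N + 1) :
    ξ ⌊x⌋₊ = ∑ i ∈ Finset.Icc 2 N, if (i : ℝ) ≤ x then slopeJump ξ i else 0 := by
  have hf : 2 ≤ ⌊x⌋₊ := Nat.le_floor (by exact_mod_cast h2)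
  have hfN : ⌊x⌋₊ < N + 1 := (Nat.floor_lt (by linarith)).2 (by exact_mod_cast hN)
  rw [← sum_slopeJump ξ hf, ← Finset.sum_filter]
  congr 1
  ext i
  simp only [Finset.mem_filter, Finset.mem_Icc, ← Nat.le_floor_iff (show 0 ≤ x by linarith)]
  omega

lemma lowerRegion_snd_le {k : ℝ} {p : ℝ × ℝ} (hp : p ∈ lowerRegion k) : p.2 ≤ k / 2 := by
  obtain ⟨h1, h2, h3⟩ := hp
  nlinarith

lemma measurableSet_lowerRegion (k : ℝ) : MeasurableSet (lowerRegion k) :=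
  measurableSet_hyperbolicSector 2 k

lemma volume_lowerRegion_ne_top (k : ℝ) : volume (lowerRegion k) ≠ ⊤ :=
  measure_ne_top_of_subset (hyperbolicSector_subset 2 k)
    (volume_hyperbolicQuadrant_ne_top two_pos two_pos k)

lemma integrableOn_slopes (ξ : ℕ → ℝ) (k : ℝ) :
    IntegrableOn (fun p : ℝ × ℝ => ξ ⌊p.1⌋₊ * ξ ⌊p.2⌋₊) (lowerRegion k) := by
  have hm : Measurable fun p : ℝ × ℝ => ξ ⌊p.1⌋₊ * ξ ⌊p.2⌋₊ :=
    ((measurable_from_nat (f := ξ)).comp (Nat.measurable_floor.comp measurable_fst)).mul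
      ((measurable_from_nat (f := ξ)).comp (Nat.measurable_floor.comp measurable_snd))
  set C := ∑ i ∈ Finset.range (⌊k / 2⌋₊ + 1), |ξ i| with hC
  have hb : ∀ x : ℝ, x ≤ k / 2 → |ξ ⌊x⌋₊| ≤ C := fun x hx =>
    Finset.single_le_sum (f := fun i => |ξ i|) (fun i _ => abs_nonneg _)
      (Finset.mem_range.2 (Nat.lt_succ_of_le (Nat.floor_mono hx)))
  refine Measure.integrableOn_of_bounded (M := C * C) (volume_lowerRegion_ne_top k)
    hm.aestronglyMeasurable ?_
  refine (ae_restrict_iff' (measurableSet_lowerRegion k)).2 (ae_of_all _ fun p hp => ?_)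
  have h2 := lowerRegion_snd_le hp
  rw [Real.norm_eq_abs, abs_mul]
  exact mul_le_mul (hb _ (hp.2.1.trans h2)) (hb _ h2) (abs_nonneg _)
    ((abs_nonneg _).trans (hb _ h2))

lemma measurableSet_quadrant (i j : ℝ) : MeasurableSet {p : ℝ × ℝ | i ≤ p.1 ∧ j ≤ p.2} :=
  (measurableSet_le measurable_const measurable_fst).inter
    (measurableSet_le measurable_const measurable_snd)

/-- On the region `x ≤ y ≤ k / 2 < N + 1`, so the jumps up to `N` account for both slopes; the
product of two step functions is the indicator of a quadrant. -/
lemma codedArea_lowerRegion {ξ : ℕ → ℝ} (hξ : ∀ i, 0 < ξ i) {N : ℕ} {k : ℝ}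
    (hk : k < 2 * (N + 1)) :
    codedArea ξ (lowerRegion k) = ∑ l ∈ Finset.Icc 2 N, ∑ m ∈ Finset.Icc 2 N,
      slopeJump ξ l * slopeJump ξ m *
        volume.real (lowerRegion k ∩ {p | (l : ℝ) ≤ p.1 ∧ (m : ℝ) ≤ p.2}) := by
  have hfin : IsFiniteMeasure (volume.restrict (lowerRegion k)) :=
    isFiniteMeasure_restrict.2 (volume_lowerRegion_ne_top k)
  rw [codedArea_eq_integral hξ (measurableSet_lowerRegion k)
    fun p hp => ⟨by linarith [hp.1], by linarith [hp.1, hp.2.1]⟩]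
  have hcongr : ∀ p ∈ lowerRegion k, ξ ⌊p.1⌋₊ * ξ ⌊p.2⌋₊ =
      ∑ l ∈ Finset.Icc 2 N, ∑ m ∈ Finset.Icc 2 N, slopeJump ξ l * slopeJump ξ m *
        {p : ℝ × ℝ | (l : ℝ) ≤ p.1 ∧ (m : ℝ) ≤ p.2}.indicator 1 p := by
    intro p hp
    have h2 := lowerRegion_snd_le hp
    rw [slope_eq_sum ξ hp.1 (N := N) (by linarith [hp.2.1]),
      slope_eq_sum ξ (hp.1.trans hp.2.1) (N := N) (by linarith), Finset.sum_mul_sum]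
    refine Finset.sum_congr rfl fun l _ => Finset.sum_congr rfl fun m _ => ?_
    by_cases h1 : (l : ℝ) ≤ p.1 <;> by_cases h2 : (m : ℝ) ≤ p.2 <;>
      simp [indicator, h1, h2]
  have hint : ∀ l m : ℕ, Integrable (fun p : ℝ × ℝ => slopeJump ξ l * slopeJump ξ m *
      {p : ℝ × ℝ | (l : ℝ) ≤ p.1 ∧ (m : ℝ) ≤ p.2}.indicator 1 p)
      (volume.restrict (lowerRegion k)) := fun l m =>
    (((integrable_const (1 : ℝ)).indicator (measurableSet_quadrant l m))).const_mul _
  rw [setIntegral_congr_fun (measurableSet_lowerRegion k) hcongr,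
    integral_finsetSum _ fun l _ => integrable_finsetSum _ fun m _ => hint l m]
  refine Finset.sum_congr rfl fun l _ => ?_
  rw [integral_finsetSum _ fun m _ => hint l m]
  refine Finset.sum_congr rfl fun m _ => ?_
  rw [integral_const_mul, integral_indicator_one (measurableSet_quadrant l m),
    measureReal_restrict_apply (measurableSet_quadrant l m), inter_comm]

lemma volume_hyperbola (k : ℝ) : volume {p : ℝ × ℝ | 2 ≤ p.1 ∧ p.1 * p.2 = k} = 0 := by
  have hm : MeasurableSet {p : ℝ × ℝ | 2 ≤ p.1 ∧ p.1 * p.2 = k} :=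
    (measurableSet_le measurable_const measurable_fst).inter
      (measurableSet_eq_fun (measurable_fst.mul measurable_snd) measurable_const)
  rw [Measure.volume_eq_prod, Measure.measure_prod_null hm]
  refine ae_of_all _ fun x => measure_mono_null (t := {k / x}) ?_ (by simp)
  intro y hy
  have hx : x ≠ 0 := by
    have := hy.1
    simp only at this
    linarith
  exact (eq_div_iff hx).2 ((mul_comm y x).trans hy.2)

/-- The upper area complements the lower one. -/
lemma codedArea_upperRegion {ξ : ℕ → ℝ} (hξ : ∀ i, 0 < ξ i) (α : ℕ) {k : ℝ}
    (hk : k ≤ (α : ℝ) - 4) :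
    codedArea ξ (upperRegion α ((α : ℝ) - k)) =
      codedArea ξ (lowerRegion ((α : ℝ) - 4)) - codedArea ξ (lowerRegion k) := by
  have hm : MeasurableSet (upperRegion α ((α : ℝ) - k)) :=
    (measurableSet_le measurable_const measurable_fst).inter
      ((measurableSet_le measurable_fst measurable_snd).inter
        ((measurableSet_le measurable_const (measurable_fst.mul measurable_snd)).inter
          (measurableSet_le (measurable_fst.mul measurable_snd) measurable_const)))
  have hpos : ∀ c : ℝ, ∀ p ∈ lowerRegion c, 0 ≤ p.1 ∧ 0 ≤ p.2 := fun c p hp =>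
    ⟨by linarith [hp.1], by linarith [hp.1, hp.2.1]⟩
  have hsub : upperRegion α ((α : ℝ) - k) ⊆ lowerRegion ((α : ℝ) - 4) :=
    fun p hp => ⟨hp.1, hp.2.1, hp.2.2.2⟩
  have hunion : lowerRegion ((α : ℝ) - 4) = upperRegion α ((α : ℝ) - k) ∪ lowerRegion k := by
    refine Subset.antisymm (fun p hp => ?_) (union_subset hsub
      fun p hp => ⟨hp.1, hp.2.1, hp.2.2.trans hk⟩)
    rcases le_total (p.1 * p.2) k with h | h
    · exact Or.inr ⟨hp.1, hp.2.1, h⟩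
    · exact Or.inl ⟨hp.1, hp.2.1, by linarith, hp.2.2⟩
  have hdisj : AEDisjoint volume (upperRegion α ((α : ℝ) - k)) (lowerRegion k) :=
    measure_mono_null (t := {p : ℝ × ℝ | 2 ≤ p.1 ∧ p.1 * p.2 = k})
      (fun p hp => ⟨hp.1.1, le_antisymm hp.2.2.2 (by linarith [hp.1.2.2.1])⟩)
      (volume_hyperbola k)
  rw [codedArea_eq_integral hξ hm fun p hp => hpos _ p (hsub hp),
    codedArea_eq_integral hξ (measurableSet_lowerRegion _) (hpos _),
    codedArea_eq_integral hξ (measurableSet_lowerRegion _) (hpos _)]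
  conv_rhs => rw [hunion]
  rw [setIntegral_union₀ hdisj (measurableSet_lowerRegion k).nullMeasurableSet
    ((integrableOn_slopes ξ _).mono_set hsub) (integrableOn_slopes ξ k), add_sub_cancel_right]

/-! ### Calculus of second derivatives -/

namespace HasSecondDerivOn

variable {A B A₂ B₂ : ℝ → ℝ} {U : Set ℝ}

lemma const (c : ℝ) (U : Set ℝ) : HasSecondDerivOn (fun _ => c) (fun _ => 0) U :=
  ⟨fun _ => 0, fun s _ => ⟨hasDerivAt_const s c, hasDerivAt_const s 0⟩⟩

lemma sub (hA : HasSecondDerivOn A A₂ U) (hB : HasSecondDerivOn B B₂ U) :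
    HasSecondDerivOn (fun s => A s - B s) (fun s => A₂ s - B₂ s) U := by
  obtain ⟨A₁, hA⟩ := hA
  obtain ⟨B₁, hB⟩ := hB
  exact ⟨fun s => A₁ s - B₁ s, fun s hs =>
    ⟨(hA s hs).1.fun_sub (hB s hs).1, (hA s hs).2.fun_sub (hB s hs).2⟩⟩

lemma const_mul (c : ℝ) (hA : HasSecondDerivOn A A₂ U) :
    HasSecondDerivOn (fun s => c * A s) (fun s => c * A₂ s) U := by
  obtain ⟨A₁, hA⟩ := hA
  exact ⟨fun s => c * A₁ s, fun s hs => ⟨(hA s hs).1.const_mul c, (hA s hs).2.const_mul c⟩⟩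

lemma sum {ι : Type*} (I : Finset ι) {F F₂ : ι → ℝ → ℝ}
    (hF : ∀ i ∈ I, HasSecondDerivOn (F i) (F₂ i) U) :
    HasSecondDerivOn (fun s => ∑ i ∈ I, F i s) (fun s => ∑ i ∈ I, F₂ i s) U := by
  choose! F₁ hF using hF
  exact ⟨fun s => ∑ i ∈ I, F₁ i s, fun s hs =>
    ⟨HasDerivAt.fun_sum fun i hi => (hF i hi s hs).1,
      HasDerivAt.fun_sum fun i hi => (hF i hi s hs).2⟩⟩

lemma congr (hU : IsOpen U) (hA : HasSecondDerivOn A A₂ U) (hAB : EqOn B A U)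
    (hAB₂ : EqOn B₂ A₂ U) : HasSecondDerivOn B B₂ U := by
  obtain ⟨A₁, hA⟩ := hA
  refine ⟨A₁, fun s hs => ⟨(hA s hs).1.congr_of_eventuallyEq
    (hAB.eventuallyEq_of_mem (hU.mem_nhds hs)), ?_⟩⟩
  rw [hAB₂ hs]
  exact (hA s hs).2

/-- The two first derivatives agree on an open set, so they have the same derivative there. -/
lemma unique (hU : IsOpen U) (hA : HasSecondDerivOn A A₂ U) (hB : HasSecondDerivOn A B₂ U) :
    EqOn A₂ B₂ U := by
  obtain ⟨A₁, hA⟩ := hA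
  obtain ⟨B₁, hB⟩ := hB
  intro s hs
  have h : A₁ =ᶠ[𝓝 s] B₁ :=
    EqOn.eventuallyEq_of_mem (fun t ht => (hA t ht).1.unique (hB t ht).1) (hU.mem_nhds hs)
  exact (hA s hs).2.unique ((hB s hs).2.congr_of_eventuallyEq h)

/-- Precomposition with a function of constant derivative. -/
lemma comp {V : Set ℝ} {t : ℝ → ℝ} {c : ℝ} (hA : HasSecondDerivOn A A₂ U)
    (ht : ∀ s ∈ V, HasDerivAt t c s ∧ t s ∈ U) :
    HasSecondDerivOn (fun s => A (t s)) (fun s => A₂ (t s) * c ^ 2) V := by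
  obtain ⟨A₁, hA⟩ := hA
  refine ⟨fun s => A₁ (t s) * c, fun s hs => ?_⟩
  obtain ⟨h, hmem⟩ := ht s hs
  refine ⟨(hA _ hmem).1.comp s h, ?_⟩
  have := ((hA _ hmem).2.comp s h).mul_const c
  rwa [mul_assoc, ← sq] at this

end HasSecondDerivOn

/-- No integer threshold `i * j` is crossed inside `(k₀, k₀ + 1)`, so the case distinction in
`hyperbolicArea` is constant there. -/
lemma natCast_mul_le_iff {k₀ i j : ℕ} {k : ℝ} (hk : k ∈ Ioo (k₀ : ℝ) (k₀ + 1)) :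
    (i : ℝ) * j ≤ k ↔ i * j ≤ k₀ := by
  constructor
  · intro h
    have : ((i * j : ℕ) : ℝ) < (k₀ + 1 : ℕ) := by
      push_cast
      exact h.trans_lt hk.2
    exact Nat.lt_succ_iff.1 (by exact_mod_cast this)
  · intro h
    have : ((i * j : ℕ) : ℝ) ≤ k₀ := by exact_mod_cast h
    push_cast at this
    exact this.trans hk.1.le

lemma hasSecondDerivOn_hyperbolicArea (k₀ : ℕ) {i j : ℕ} (hi : 0 < i) (hj : 0 < j) :
    HasSecondDerivOn (hyperbolicArea i j) (fun k => (if i * j ≤ k₀ then 1 else 0) * (1 / k))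
      (Ioo (k₀ : ℝ) (k₀ + 1)) := by
  have hi' : (0 : ℝ) < i := by exact_mod_cast hi
  have hj' : (0 : ℝ) < j := by exact_mod_cast hj
  by_cases h : i * j ≤ k₀
  · have key : HasSecondDerivOn (fun k : ℝ => k * Real.log (k / (i * j)) - k + i * j)
        (fun k => 1 / k) (Ioo (k₀ : ℝ) (k₀ + 1)) := by
      refine ⟨fun k => Real.log (k / (i * j)), fun k hk => ?_⟩
      have hk0 : 0 < k := (Nat.cast_nonneg k₀).trans_lt hk.1
      have hlog : HasDerivAt (fun k : ℝ => Real.log (k / (i * j))) (1 / k) k := by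
        have := ((hasDerivAt_id' k).div_const ((i : ℝ) * j)).log
          (div_pos hk0 (mul_pos hi' hj')).ne'
        convert this using 1
        field_simp
      refine ⟨?_, hlog⟩
      have := (((hasDerivAt_id' k).fun_mul hlog).fun_sub (hasDerivAt_id' k)).add_const
        ((i : ℝ) * j)
      rwa [one_mul, mul_one_div_cancel hk0.ne', add_sub_cancel_right] at this
    refine key.congr isOpen_Ioo (fun k hk => ?_) fun k _ => by simp [h]
    rw [hyperbolicArea, if_pos ((natCast_mul_le_iff hk).2 h)]
  · refine (HasSecondDerivOn.const 0 _).congr isOpen_Ioo (fun k hk => ?_) fun k _ => by simp [h]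
    rw [hyperbolicArea, if_neg (mt (natCast_mul_le_iff hk).1 h)]

/-! ### Closed form of the essential values -/

/-- The coefficient of the product of the jumps at `l` and `m` in the second derivative of the
lower area on `(k₀, k₀ + 1)`. -/
def jumpCoeff (k₀ l m : ℕ) : ℝ :=
  if m ≤ l then 1 / 2 * (if l * l ≤ k₀ then 1 else 0)
  else (if l * m ≤ k₀ then 1 else 0) - 1 / 2 * (if m * m ≤ k₀ then 1 else 0)

/-- The value of the lower essential polynomial at `ξ`. -/
def lowerValue (ξ : ℕ → ℝ) (k₀ : ℕ) : ℝ :=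
  ∑ l ∈ Finset.Icc 2 (k₀ / 2), ∑ m ∈ Finset.Icc 2 (k₀ / 2),
    slopeJump ξ l * slopeJump ξ m * jumpCoeff k₀ l m

/-- Provides the witness for the choices made by `Classical.epsilon`. -/
lemma exists_eval_eq_lowerValue (k₀ : ℕ) :
    ∃ P : MvPolynomial ℕ ℝ, ∀ ξ : ℕ → ℝ, MvPolynomial.eval ξ P = lowerValue ξ k₀ := by
  let d : ℕ → MvPolynomial ℕ ℝ := fun i =>
    if i = 2 then .X 2 else .X i - .X (i - 1)
  have hd : ∀ (ξ : ℕ → ℝ) i, MvPolynomial.eval ξ (d i) = slopeJump ξ i := by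
    intro ξ i
    by_cases h : i = 2 <;> simp [d, slopeJump, h]
  exact ⟨∑ l ∈ Finset.Icc 2 (k₀ / 2), ∑ m ∈ Finset.Icc 2 (k₀ / 2),
    d l * d m * .C (jumpCoeff k₀ l m), fun ξ => by simp [hd, lowerValue]⟩

lemma hasSecondDerivOn_lowerRegion {ξ : ℕ → ℝ} (hξ : ∀ i, 0 < ξ i) (k₀ : ℕ) :
    HasSecondDerivOn (fun k => codedArea ξ (lowerRegion k))
      (fun k => 1 / k * lowerValue ξ k₀) (Ioo (k₀ : ℝ) (k₀ + 1)) := by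
  have hvol : ∀ l m : ℕ, 2 ≤ l → 2 ≤ m → HasSecondDerivOn
      (fun k => volume.real (lowerRegion k ∩ {p | (l : ℝ) ≤ p.1 ∧ (m : ℝ) ≤ p.2}))
      (fun k => jumpCoeff k₀ l m * (1 / k)) (Ioo (k₀ : ℝ) (k₀ + 1)) := by
    intro l m hl hm
    have hl' : (2 : ℝ) ≤ l := by exact_mod_cast hl
    have hH := fun i j (hi : 2 ≤ i) (hj : 2 ≤ j) =>
      hasSecondDerivOn_hyperbolicArea k₀ (i := i) (j := j) (by omega) (by omega)
    by_cases hml : m ≤ l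
    · refine ((hH l l hl hl).const_mul (1 / 2)).congr isOpen_Ioo (fun k _ => ?_) fun k _ => ?_
      · rw [volumeReal_lowerRegion_inter hl', if_pos (by exact_mod_cast hml)]
        ring
      · simp only [jumpCoeff, if_pos hml]
        ring
    · refine ((hH l m hl hm).sub ((hH m m hm hm).const_mul (1 / 2))).congr isOpen_Ioo
        (fun k _ => ?_) fun k _ => ?_
      · rw [volumeReal_lowerRegion_inter hl', if_neg (by exact_mod_cast hml)]
        ring
      · simp only [jumpCoeff, if_neg hml]
        ring
  refine (HasSecondDerivOn.sum (Finset.Icc 2 (k₀ / 2)) fun l hl =>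
    HasSecondDerivOn.sum (Finset.Icc 2 (k₀ / 2)) fun m hm =>
      (hvol l m (Finset.mem_Icc.1 hl).1 (Finset.mem_Icc.1 hm).1).const_mul
        (slopeJump ξ l * slopeJump ξ m)).congr isOpen_Ioo (fun k hk => ?_) fun k _ => ?_
  · refine codedArea_lowerRegion hξ ?_
    -- The cutoff `N = k₀ / 2`, rounded down, still works for all `k < k₀ + 1`.
    have : k₀ + 1 ≤ 2 * (k₀ / 2 + 1) := by omega
    have : ((k₀ + 1 : ℕ) : ℝ) ≤ (2 * (k₀ / 2 + 1) : ℕ) := by exact_mod_cast this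
    push_cast at this
    exact hk.2.trans_le this
  · simp only [lowerValue, Finset.mul_sum]
    exact Finset.sum_congr rfl fun l _ => Finset.sum_congr rfl fun m _ => by ring

/-- Decoding is affine with slope `1 / ξ k₀` on this interval, which produces the factor `1 / ξ k₀ ^
2`. -/
lemma hasSecondDerivOn_lowerArea {ξ : ℕ → ℝ} (hξ : ∀ i, 0 < ξ i) (k₀ : ℕ) :
    HasSecondDerivOn (lowerArea ξ)
      (fun s => 1 / ξ k₀ ^ 2 * (1 / decoding ξ s) * lowerValue ξ k₀)
      (Ioo (coding ξ k₀) (coding ξ ((k₀ : ℝ) + 1))) := by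
  refine ((hasSecondDerivOn_lowerRegion hξ k₀).comp (t := decoding ξ) (c := 1 / ξ k₀)
    fun s hs => ⟨?_, (decoding_eq hξ k₀ hs).2⟩).congr isOpen_Ioo (fun s _ => rfl) fun s _ => ?_
  · have h : decoding ξ =ᶠ[𝓝 s] fun s => k₀ + (s - coding ξ k₀) / ξ k₀ := by
      filter_upwards [isOpen_Ioo.mem_nhds hs] with t ht
      exact (decoding_eq hξ k₀ ht).1
    exact ((((hasDerivAt_id s).sub_const (coding ξ k₀)).div_const (ξ k₀)).const_add
      (k₀ : ℝ)).congr_of_eventuallyEq h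
  · simp only [div_pow, one_pow]
    ring

lemma coding_lt_coding_add_one {ξ : ℕ → ℝ} (hξ : ∀ i, 0 < ξ i) (k₀ : ℕ) :
    coding ξ k₀ < coding ξ ((k₀ : ℝ) + 1) := by
  rw [coding_natCast_add_one]
  exact lt_add_of_pos_right _ (hξ k₀)

/-- The value left in a second derivative of the given form is determined by the function. -/
lemma eq_of_hasSecondDerivOn {ξ : ℕ → ℝ} (hξ : ∀ i, 0 < ξ i) (k₀ : ℕ) {A : ℝ → ℝ} {v w : ℝ}
    (hv : HasSecondDerivOn A (fun s => 1 / ξ k₀ ^ 2 * (1 / decoding ξ s) * v)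
      (Ioo (coding ξ k₀) (coding ξ ((k₀ : ℝ) + 1))))
    (hw : HasSecondDerivOn A (fun s => 1 / ξ k₀ ^ 2 * (1 / decoding ξ s) * w)
      (Ioo (coding ξ k₀) (coding ξ ((k₀ : ℝ) + 1)))) : v = w := by
  obtain ⟨s, hs⟩ := nonempty_Ioo.2 (coding_lt_coding_add_one hξ k₀)
  have h0 : 0 < decoding ξ s := (Nat.cast_nonneg k₀).trans_lt (decoding_eq hξ k₀ hs).2.1
  have hpos : 0 < 1 / ξ k₀ ^ 2 * (1 / decoding ξ s) :=
    mul_pos (one_div_pos.2 (pow_pos (hξ k₀) 2)) (one_div_pos.2 h0)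
  exact mul_left_cancel₀ hpos.ne' (hv.unique isOpen_Ioo hw hs)

/-- Whichever polynomial is chosen, its value at a positive `ξ` is forced by the second derivative;
its uniqueness as a polynomial is not required. -/
lemma essentialX_eq {ξ : ℕ → ℝ} (hξ : ∀ i, 0 < ξ i) (k₀ : ℕ) :
    essentialX ξ k₀ = lowerValue ξ k₀ := by
  have h : IsLowerEssentialPolynomial k₀ (lowerEssentialPolynomial k₀) := by
    refine Classical.epsilon_spec ?_
    obtain ⟨P, hP⟩ := exists_eval_eq_lowerValue k₀
    refine ⟨P, fun ξ hξ => ?_⟩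
    rw [hP]
    exact hasSecondDerivOn_lowerArea hξ k₀
  exact eq_of_hasSecondDerivOn hξ k₀ (h ξ hξ) (hasSecondDerivOn_lowerArea hξ k₀)

/-- The upper area is a constant minus the lower area, whence the sign. The bound `n + 5 ≤ α` keeps
the decoded variable below `α - 4`. -/
lemma hasSecondDerivOn_upperArea {ξ : ℕ → ℝ} (hξ : ∀ i, 0 < ξ i) {α n : ℕ} (hn : n + 5 ≤ α) :
    HasSecondDerivOn (upperArea α ξ)
      (fun s => 1 / ξ n ^ 2 * (1 / decoding ξ s) * -lowerValue ξ n)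
      (Ioo (coding ξ n) (coding ξ ((n : ℝ) + 1))) := by
  refine ((HasSecondDerivOn.const (codedArea ξ (lowerRegion ((α : ℝ) - 4))) _).sub
    (hasSecondDerivOn_lowerArea hξ n)).congr isOpen_Ioo (fun s hs => ?_) fun s _ => by simp
  have hn' : ((n + 5 : ℕ) : ℝ) ≤ α := by exact_mod_cast hn
  push_cast at hn'
  exact codedArea_upperRegion hξ α (by linarith [(decoding_eq hξ n hs).2.2])

lemma essentialY_eq {ξ : ℕ → ℝ} (hξ : ∀ i, 0 < ξ i) {α k₀ : ℕ} (h4 : 4 ≤ k₀) (hk : k₀ + 1 ≤ α) :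
    essentialY α ξ k₀ = -lowerValue ξ (α - k₀ - 1) := by
  obtain ⟨n, rfl⟩ := Nat.exists_eq_add_of_le hk
  have hn : k₀ + 1 + n - k₀ - 1 = n := by omega
  have hc : (((k₀ + 1 + n : ℕ) : ℝ) - k₀ - 1 = n) ∧
      ((k₀ + 1 + n : ℕ) : ℝ) - k₀ = (n : ℝ) + 1 := by
    push_cast
    constructor <;> ring
  have h : IsUpperEssentialPolynomial (k₀ + 1 + n) k₀
      (upperEssentialPolynomial (k₀ + 1 + n) k₀) := by
    refine Classical.epsilon_spec ?_
    obtain ⟨P, hP⟩ := exists_eval_eq_lowerValue n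
    refine ⟨-P, fun ξ hξ => ?_⟩
    rw [hc.1, hc.2, hn, map_neg, hP]
    exact hasSecondDerivOn_upperArea hξ (by omega)
  have h' := h ξ hξ
  rw [hc.1, hc.2, hn] at h'
  rw [hn]
  exact eq_of_hasSecondDerivOn hξ n h' (hasSecondDerivOn_upperArea hξ (by omega))

/-! ### Limits as `u` tends to `1` -/

/-- If all the coefficients that occur tend to `t`, the value of the lower essential polynomial
tends to `t ^ 2 / 2`. -/
lemma tendsto_lowerValue {ι : Type*} {F : Filter ι} {ξ : ι → ℕ → ℝ} {t : ℝ} {k₀ : ℕ}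
    (hk : 4 ≤ k₀) (hξ : ∀ i, 2 ≤ i → i ≤ k₀ / 2 → Tendsto (fun u => ξ u i) F (𝓝 t)) :
    Tendsto (fun u => lowerValue (ξ u) k₀) F (𝓝 (1 / 2 * t ^ 2)) := by
  have hd : ∀ i ∈ Finset.Icc 2 (k₀ / 2),
      Tendsto (fun u => slopeJump (ξ u) i) F (𝓝 (if i = 2 then t else 0)) := by
    intro i hi
    rw [Finset.mem_Icc] at hi
    unfold slopeJump
    split_ifs with h
    · exact hξ 2 le_rfl (by omega)
    · simpa using (hξ i hi.1 hi.2).sub (hξ (i - 1) (by omega) (by omega))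
  have h := tendsto_finsetSum (Finset.Icc 2 (k₀ / 2)) fun l hl =>
    tendsto_finsetSum (Finset.Icc 2 (k₀ / 2)) fun m hm =>
      ((hd l hl).mul (hd m hm)).mul_const (jumpCoeff k₀ l m)
  have h2 : 2 ∈ Finset.Icc 2 (k₀ / 2) := Finset.mem_Icc.2 ⟨le_rfl, by omega⟩
  -- Only the term `l = m = 2` survives; its coefficient is `1 / 2` because `2 * 2 ≤ k₀`.
  rw [Finset.sum_eq_single_of_mem 2 h2 fun l _ hl => by simp [hl],
    Finset.sum_eq_single_of_mem 2 h2 fun m _ hm => by simp [hm]] at h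
  simp only [if_true, jumpCoeff, le_refl, if_pos (show 2 * 2 ≤ k₀ by omega)] at h
  have ht : t * t * (1 / 2 * 1) = 1 / 2 * t ^ 2 := by ring
  rwa [ht] at h

/-- In a scalar family, the coefficients between `2` and `α / 2 - 1` tend to the same limit. -/
theorem tendsto_coefficient {α : ℕ} {a b : ℝ}
    {ξ : ℝ → ℕ → ℝ} {G : ℝ → ℝ → ℝ}
    (hG : ∀ u : ℝ, 1 < u → IsScalarGoldbachFunction α a b u (ξ u) (G u)) {i : ℕ} (h2 : 2 ≤ i)
    (hi : i ≤ α / 2 - 1) : Tendsto (fun u => ξ u i) (𝓝[>] 1) (𝓝 √a) := by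
  have hpos : ∀ u : ℝ, 1 < u → ∀ i, 0 < ξ u i := fun u hu =>
    (hG u hu).isGoldbach.coefficients.pos
  have ha : 0 < a := by
    rw [← (hG 2 one_lt_two).sq_two]
    exact pow_pos (hpos 2 one_lt_two 2) 2
  have hev : ∀ᶠ u : ℝ in 𝓝[>] 1, 1 < u := self_mem_nhdsWithin
  have hu : Tendsto (fun u : ℝ => u ^ 2) (𝓝[>] 1) (𝓝 1) := by
    have : Tendsto (fun u : ℝ => u ^ 2) (𝓝 1) (𝓝 (1 ^ 2)) := (continuous_pow 2).tendsto 1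
    rw [one_pow] at this
    exact this.mono_left nhdsWithin_le_nhds
  induction i using Nat.strong_induction_on with
  | _ i ih =>
    suffices h : Tendsto (fun u => ξ u i ^ 2) (𝓝[>] 1) (𝓝 a) by
      refine h.sqrt.congr' ?_
      filter_upwards [hev] with u hu
      exact Real.sqrt_sq (hpos u hu i).le
    rcases h2.eq_or_lt with rfl | h2
    · refine tendsto_const_nhds.congr' ?_
      filter_upwards [hev] with u hu
      exact (hG u hu).sq_two.symm
    have hprev : Tendsto (fun u => ξ u (i - 1) ^ 2) (𝓝[>] 1) (𝓝 a) := by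
      have := (ih (i - 1) (by omega) (by omega) (by omega)).pow 2
      rwa [Real.sq_sqrt ha.le] at this
    have hfactor : ∀ f : ℝ → ℝ, Tendsto f (𝓝[>] 1) (𝓝 1) →
        (∀ u, 1 < u → ξ u i ^ 2 = f u * ξ u (i - 1) ^ 2) →
        Tendsto (fun u => ξ u i ^ 2) (𝓝[>] 1) (𝓝 a) := by
      intro f hf hfu
      have := hf.mul hprev
      rw [one_mul] at this
      refine this.congr' ?_
      filter_upwards [hev] with u hu
      exact (hfu u hu).symm
    by_cases hr : i = 3 ∨ i = 4 ∨ (i.Prime ∧ 5 ≤ i ∧ i ≤ α / 2 - 1)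
    · exact hfactor _ hu fun u hu => ((hG u hu).ratio i hr).2
    have h5 : 5 ≤ i := by omega
    -- For `k ≤ i` the value at `k` involves only indices `j ≤ k / 2 < i`, so the induction
    -- hypothesis applies even at `k = i`.
    have hx : ∀ k, 4 ≤ k → k ≤ i →
        Tendsto (fun u => essentialX (ξ u) k) (𝓝[>] 1) (𝓝 (1 / 2 * √a ^ 2)) := by
      intro k h4 hki
      refine (tendsto_lowerValue h4 fun j hj hjk =>
        ih j (by omega) hj (by omega)).congr' ?_
      filter_upwards [hev] with u hu
      exact (essentialX_eq (hpos u hu) k).symm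
    have hne : 1 / 2 * √a ^ 2 ≠ 0 := by
      rw [Real.sq_sqrt ha.le]
      positivity
    have hquot := (hx i (by omega) le_rfl).div (hx (i - 1) (by omega) (by omega)) hne
    rw [div_self hne] at hquot
    exact hfactor _ hquot fun u hu =>
      (hG u hu).isGoldbach.coefficients.lower_not_prime i (fun hp => hr (by tauto)) h5 hi

end Goldbach

end

theorem proposition3p1p14 (α : ℕ) (hα : Even α) (hα16 : 16 ≤ α) (a b : ℝ)
    (ξ : ℝ → ℕ → ℝ) (G : ℝ → ℝ → ℝ)
    (hG : ∀ u : ℝ, 1 < u → Goldbach.IsScalarGoldbachFunction α a b u (ξ u) (G u)) :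
    (∀ k₀ : ℕ, 4 ≤ k₀ → k₀ ≤ α - 5 →
      Tendsto (fun u : ℝ => Goldbach.essentialX (ξ u) k₀) (𝓝[>] 1) (𝓝 (1 / 2 * a))) ∧
    (∀ k₀ : ℕ, 4 ≤ k₀ → k₀ ≤ α / 2 - 1 →
      Tendsto (fun u : ℝ => |Goldbach.essentialY α (ξ u) k₀|) (𝓝[>] 1) (𝓝 (1 / 2 * a))) := by
  have hpos : ∀ u : ℝ, 1 < u → ∀ i, 0 < ξ u i := fun u hu =>
    (hG u hu).isGoldbach.coefficients.pos
  have ha : 0 ≤ a := (hG 2 one_lt_two).sq_two ▸ sq_nonneg _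
  have hev : ∀ᶠ u : ℝ in 𝓝[>] 1, 1 < u := self_mem_nhdsWithin
  have hlim : ∀ k₀ : ℕ, 4 ≤ k₀ → k₀ ≤ α - 5 →
      Tendsto (fun u : ℝ => Goldbach.lowerValue (ξ u) k₀) (𝓝[>] 1) (𝓝 (1 / 2 * a)) := by
    intro k₀ h4 hk
    have := Goldbach.tendsto_lowerValue h4 fun i hi hik =>
      Goldbach.tendsto_coefficient hG (i := i) hi (by omega)
    rwa [Real.sq_sqrt ha] at this
  refine ⟨fun k₀ h4 hk => (hlim k₀ h4 hk).congr' ?_, fun k₀ h4 hk => ?_⟩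
  · filter_upwards [hev] with u hu
    exact (Goldbach.essentialX_eq (hpos u hu) k₀).symm
  -- The range `4 ≤ k₀ ≤ α / 2 - 1` places `α - k₀ - 1` between `α / 2` and `α - 5`, within the
  -- range of `hlim`.
  · have := (hlim (α - k₀ - 1) (by omega) (by omega)).abs
    rw [abs_of_nonneg (by positivity)] at this
    refine this.congr' ?_
    filter_upwards [hev] with u hu
    rw [Goldbach.essentialY_eq (hpos u hu) h4 (by omega), abs_neg]
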